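/- A *$C$-group* is a group $G$ together with a finite presentation $$G=\langle x_1,\dots,x_m \mid x_i = w^{-1}x_jw,\ (i,j,w)\in R\rangle,$$ where $R$ is a finite set of triples with $1\le i,j\le m$ and $w$ an element of the free group $\mathbb F_m$ on $x_1,\dots,x_m$ (a *$C$-presentation*). The elements $x_1,\dots,x_m$ of $G$ and all their conjugates are the *$C$-generators* of $G$; two $C$-presentations of $G$ with the same set of $C$-generators define the same $C$-group. The $C$-presentation is a *Hurwitz $C$-presentation* if for each $i$ the relation $x_i=w^{-1}x_iw$ with $w=x_1x_2\cdots x_m$ is one of its relations; a *Hurwitz $C$-group* is a $C$-group which possesses a Hurwitz $C$-presentation. A $C$-group $G$ is *irreducible* if $G/G'\simeq\mathbb Z$. Let $\nu:G\to\mathbb Z$ be the homomorphism sending every $C$-generator to $1$, and let $N=\ker\nu$. Conjugation $g\mapsto x^{-1}gx$ by a $C$-generator $x$ of $G$ induces a linear map $h_{\mathbb C}$ of $(N/N')\otimes\mathbb C$ which does not depend on the choice of $x$. The *Alexander polynomial* of $G$ is $\Delta(t)=\det(h_{\mathbb C}-t\,\mathrm{Id})$ (and $\Delta(t)=0$ if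 $(N/N')\otimes\mathbb C$ is infinite dimensional). **Theorem.** A polynomial $P(t)\in\mathbb Z[t]$ is the Alexander polynomial of some irreducible Hurwitz $C$-group if and only if all complex roots of $P(t)$ are roots of unity and $P(1)=1$. -/

import Mathlib

open Polynomial TensorProduct

noncomputable section

/-- A finite `C`-presentation of a group `G`: generators `x₁, …, x_m` of `G` and a finite set of
triples `(i, j, w)` with `w` in the free group `𝔽_m`, such that `G` is presented by the generators
`xᵢ` and the defining relations `xᵢ = w⁻¹ xⱼ w`. A group with such a presentation is a `C`-group. -/
structure CPresentation (G : Type*) [Group G] where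
  /-- the number `m` of generators -/
  deg : ℕ
  /-- the elements `x₁, …, x_m` of `G` -/
  gen : Fin deg → G
  /-- the triple `(i, j, w)` stands for the relation `xᵢ = w⁻¹ xⱼ w` -/
  rel : Set (Fin deg × Fin deg × FreeGroup (Fin deg))
  rel_finite : rel.Finite
  lift_surjective : Function.Surjective (FreeGroup.lift gen)
  ker_lift : (FreeGroup.lift gen).ker = Subgroup.normalClosure
    {r | ∃ i j w, (i, j, w) ∈ rel ∧
      r = (FreeGroup.of i)⁻¹ * (w⁻¹ * FreeGroup.of j * w)}

namespace CPresentation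

variable {G : Type*} [Group G]

/-- The `C`-generators: the elements `x₁, …, x_m` and all their conjugates in `G`. -/
def cGenerators (S : CPresentation G) : Set G :=
  {g | ∃ i, IsConj (S.gen i) g}

/-- A Hurwitz `C`-presentation of degree `m`: for each `i`, one of the words `w` in the relations
`xᵢ = w⁻¹ xᵢ w` is the product `x₁ ⋯ x_m`. -/
def IsHurwitzPresentation (S : CPresentation G) : Prop :=
  ∀ i : Fin S.deg, (i, i, (List.ofFn fun j : Fin S.deg => FreeGroup.of j).prod) ∈ S.rel

/-- The `C`-group `G` (with the `C`-structure given by `S`) is a Hurwitz `C`-group if it possesses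
a Hurwitz `C`-presentation. A second presentation `T` of `G` defines the same `C`-group when it has
the same `C`-generators, that is, when the identity is a `C`-isomorphism. -/
def IsHurwitz (S : CPresentation G) : Prop :=
  ∃ T : CPresentation G, T.cGenerators = S.cGenerators ∧ T.IsHurwitzPresentation

/-- The `C`-group is irreducible if `G / G' ≃ ℤ`. -/
def IsIrreducible (_S : CPresentation G) : Prop :=
  Nonempty (Abelianization G ≃* Multiplicative ℤ)

theorem ker_lift_le (S : CPresentation G) :
    (FreeGroup.lift S.gen).ker ≤
      (FreeGroup.lift fun _ : Fin S.deg => Multiplicative.ofAdd (1 : ℤ)).ker := by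
  rw [S.ker_lift]
  refine Subgroup.normalClosure_le_normal ?_
  rintro r ⟨i, j, w, -, rfl⟩
  simp [MonoidHom.mem_ker, mul_comm]

/-- The canonical homomorphism `ν : G → 𝔽₁ = ℤ` sending every `C`-generator to the generator. -/
def nu (S : CPresentation G) : G →* Multiplicative ℤ :=
  MonoidHom.liftOfSurjective (FreeGroup.lift S.gen) S.lift_surjective
    ⟨FreeGroup.lift fun _ => Multiplicative.ofAdd (1 : ℤ), S.ker_lift_le⟩

theorem nu_gen (S : CPresentation G) (i : Fin S.deg) :
    S.nu (S.gen i) = Multiplicative.ofAdd (1 : ℤ) := by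
  have h := MonoidHom.liftOfRightInverse_comp_apply (FreeGroup.lift S.gen) _
    (Function.rightInverse_surjInv S.lift_surjective)
    ⟨FreeGroup.lift fun _ => Multiplicative.ofAdd (1 : ℤ), S.ker_lift_le⟩ (FreeGroup.of i)
  rw [FreeGroup.lift_apply_of, FreeGroup.lift_apply_of] at h
  exact h

theorem nu_cGenerator (S : CPresentation G) {x : G} (hx : x ∈ S.cGenerators) :
    S.nu x = Multiplicative.ofAdd (1 : ℤ) := by
  obtain ⟨i, hi⟩ := hx
  rw [← isConj_iff_eq.mp (S.nu.map_isConj hi), S.nu_gen]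

/-- The group `N = ker ν`. -/
abbrev N (S : CPresentation G) : Subgroup G := S.nu.ker

/-- The complex vector space `(N / N') ⊗ ℂ`. -/
abbrev NC (S : CPresentation G) : Type _ := ℂ ⊗[ℤ] Additive (Abelianization S.N)

/-- The map induced on `(N / N') ⊗ ℂ` by `g ↦ x⁻¹ g x` on `N`. -/
def conjC (S : CPresentation G) (x : G) : S.NC →ₗ[ℂ] S.NC :=
  LinearMap.baseChange ℂ (AddMonoidHom.toIntLinearMap (MonoidHom.toAdditive
    (Abelianization.map (MulAut.conjNormal x⁻¹ : MulAut S.N).toMonoidHom)))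

/-- The map on `(N / N') ⊗ ℂ` depends only on `ν x`; in particular it is the same for all
`C`-generators `x`. -/
theorem conjC_eq (S : CPresentation G) {x y : G} (h : S.nu x = S.nu y) :
    S.conjC x = S.conjC y := by
  have hn : y⁻¹ * x ∈ S.N := by simp [MonoidHom.mem_ker, h]
  have key : Abelianization.map (MulAut.conjNormal x⁻¹ : MulAut S.N).toMonoidHom =
      Abelianization.map (MulAut.conjNormal y⁻¹ : MulAut S.N).toMonoidHom := by
    ext g
    have e : (MulAut.conjNormal x⁻¹ : MulAut S.N) g =
        (⟨y⁻¹ * x, hn⟩ : S.N)⁻¹ * (MulAut.conjNormal y⁻¹ : MulAut S.N) g * ⟨y⁻¹ * x, hn⟩ := by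
      ext
      simp [mul_assoc]
    have e' := congrArg (Abelianization.of (G := S.N)) e
    rw [map_mul, map_mul, map_inv Abelianization.of, mul_comm, mul_inv_cancel_left] at e'
    exact e'
  rw [conjC, conjC, key]

/-- The first of the generators `x₁, …, x_m` (and `1` for the empty presentation, where
`N = 1`). -/
def baseGen (S : CPresentation G) : G :=
  if h : 0 < S.deg then S.gen ⟨0, h⟩ else 1

/-- The automorphism `h_ℂ` of `(N / N') ⊗ ℂ` given by conjugation `g ↦ x⁻¹ g x` by one of the
`C`-generators `x`. -/
def hC (S : CPresentation G) : S.NC →ₗ[ℂ] S.NC := S.conjC S.baseGen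

theorem hC_eq (S : CPresentation G) {x : G} (hx : x ∈ S.cGenerators) : S.hC = S.conjC x := by
  refine S.conjC_eq ?_
  have h : 0 < S.deg := by
    obtain ⟨i, -⟩ := hx
    exact i.pos
  rw [baseGen, dif_pos h, S.nu_gen, S.nu_cGenerator hx]

open Classical in
/-- The Alexander polynomial `Δ(t) = det (h_ℂ - t Id)` of the `C`-group, and `0` if `(N / N') ⊗ ℂ`
is infinite dimensional. (`LinearMap.charpoly` is `det (t Id - h_ℂ)`, whence the sign.) -/
def alexanderPolynomial (S : CPresentation G) : ℂ[X] :=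
  if _h : FiniteDimensional ℂ S.NC then
    (-1) ^ Module.finrank ℂ S.NC * S.hC.charpoly
  else 0

end CPresentation

end

/-! Let `h` be conjugation by a `C`-generator on the abelian group `N/N'`. For a Hurwitz
presentation with `m` generators, their product is central and has `ν`-value `m`. Conjugation on
`N/N'` depends only on the `ν`-value, so `h ^ m = 1`. Hence `N/N'` is finitely generated over `ℤ`
and the eigenvalues of `h` are roots of unity. Irreducibility gives `N ≤ G'`, which makes `h - 1`
surjective, and a Nakayama argument gives an integral `r` with `r(h) = 0` and `r(1) = 1`. If a
primitive `n`-th root of unity is an eigenvalue, then `Φ_n` divides `r`, so `Φ_n(1)` is a unit. This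
forces `n > 2` and `Φ_n(1) = 1`, and the degree of `Φ_n` is even. So the sign in `Δ` disappears, and
`Δ` is a product of such `Φ_n`.

Conversely, such a `P` is a product of cyclotomic polynomials with value `1` at `1`, hence the
characteristic polynomial of an integral matrix `A` with `A ^ k = 1` and `det (1 - A) = 1`. In `ℤᵈ ⋊
ℤ` all elements `(a, 1)` are conjugate and have the same central `k`-th power, so repeating each
generator `k` times makes the total product central. The monodromy relations `c = 1` are not of the
form allowed in a `C`-presentation; they are weakened to "`c` commutes with the base generator".
This loses nothing on `N/N'`, since `h - 1` is injective there and kills the class of `c`. The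
presented group need not be `ℤᵈ ⋊ ℤ`, but its map to that group shows that `N/N'` is free of rank
`d` with monodromy `A` (`alexanderPolynomial_eq_charpoly`). -/

noncomputable section

/-! ### The abelianized kernel and its crossed homomorphism -/

section KernelModule

variable {G : Type*} [Group G]

/-- The abelianized kernel of `ν`, written additively. -/
abbrev AbKer (ν : G →* Multiplicative ℤ) : Type _ := Additive (Abelianization ν.ker)

/-- The class of an element of the kernel in the abelianized kernel. -/
def abKerMk (ν : G →* Multiplicative ℤ) (n : ν.ker) : AbKer ν :=
  Additive.ofMul (Abelianization.of n)

/-- The map induced on the abelianized kernel by `n ↦ g⁻¹ n g`. -/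
def conjAb (ν : G →* Multiplicative ℤ) (g : G) : Module.End ℤ (AbKer ν) :=
  AddMonoidHom.toIntLinearMap (MonoidHom.toAdditive
    (Abelianization.map (MulAut.conjNormal g⁻¹ : MulAut ν.ker).toMonoidHom))

variable {ν : G →* Multiplicative ℤ}

theorem abKerMk_mul (a b : ν.ker) : abKerMk ν (a * b) = abKerMk ν a + abKerMk ν b := rfl

theorem abKerMk_inv (a : ν.ker) : abKerMk ν a⁻¹ = -abKerMk ν a := rfl

theorem abKerMk_surjective : Function.Surjective (abKerMk ν) := fun a =>
  QuotientGroup.mk_surjective (Additive.toMul a)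

theorem conjAb_abKerMk (g : G) (n : ν.ker) :
    conjAb ν g (abKerMk ν n) = abKerMk ν ((MulAut.conjNormal g⁻¹ : MulAut ν.ker) n) := rfl

theorem abKerMk_congr {a b : ν.ker} (h : (a : G) = b) : abKerMk ν a = abKerMk ν b :=
  congrArg _ (Subtype.ext h)

theorem conjAb_one : conjAb ν 1 = 1 := by
  refine LinearMap.ext fun a => ?_
  obtain ⟨n, rfl⟩ := abKerMk_surjective a
  exact abKerMk_congr (by simp)

theorem conjAb_mul (g k : G) : conjAb ν (g * k) = conjAb ν k * conjAb ν g := by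
  refine LinearMap.ext fun a => ?_
  obtain ⟨n, rfl⟩ := abKerMk_surjective a
  exact abKerMk_congr (by simp [mul_assoc])

theorem conjAb_pow (g : G) (n : ℕ) : conjAb ν (g ^ n) = conjAb ν g ^ n := by
  induction n with
  | zero => simp [conjAb_one]
  | succ n ih => rw [pow_succ', conjAb_mul, ih, pow_succ]

theorem conjAb_of_ker {g : G} (hg : g ∈ ν.ker) : conjAb ν g = 1 := by
  refine LinearMap.ext fun a => ?_
  obtain ⟨n, rfl⟩ := abKerMk_surjective a
  have e : (MulAut.conjNormal g⁻¹ : MulAut ν.ker) n = (⟨g, hg⟩ : ν.ker)⁻¹ * n * ⟨g, hg⟩ := by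
    ext
    simp
  rw [conjAb_abKerMk, e, abKerMk_mul, abKerMk_mul, abKerMk_inv, Module.End.one_apply]
  abel

theorem conjAb_congr {g k : G} (h : ν g = ν k) : conjAb ν g = conjAb ν k := by
  have hn : g * k⁻¹ ∈ ν.ker := by simp [MonoidHom.mem_ker, h]
  rw [← inv_mul_cancel_right g k, conjAb_mul, conjAb_of_ker hn, mul_one]

variable {x : G}

theorem map_mul_zpow_neg (hx : ν x = Multiplicative.ofAdd 1) (g : G) :
    g * x ^ (-(ν g).toAdd) ∈ ν.ker := by
  rw [MonoidHom.mem_ker, map_mul, map_zpow, hx, ← ofAdd_zsmul]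
  simp

/-- The crossed homomorphism sending `g` to the class of `g x ^ (-ν g)`. -/
def fox (hx : ν x = Multiplicative.ofAdd 1) (g : G) : AbKer ν :=
  abKerMk ν ⟨g * x ^ (-(ν g).toAdd), map_mul_zpow_neg hx g⟩

variable (hx : ν x = Multiplicative.ofAdd 1)

theorem fox_coe (n : ν.ker) : fox hx n = abKerMk ν n :=
  abKerMk_congr (by simp [show ν (n : G) = 1 from n.2])

theorem fox_of_ker {g : G} (hg : g ∈ ν.ker) : fox hx g = abKerMk ν ⟨g, hg⟩ := fox_coe hx ⟨g, hg⟩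

theorem fox_mul (g k : G) : fox hx (g * k) = fox hx g + conjAb ν g⁻¹ (fox hx k) := by
  have h : conjAb ν g⁻¹ = conjAb ν (x ^ (-(ν g).toAdd)) := conjAb_congr (by
    rw [map_inv, map_zpow, hx, ← ofAdd_zsmul]
    simp)
  rw [h, fox, fox, fox, conjAb_abKerMk, ← abKerMk_mul]
  refine abKerMk_congr ?_
  rw [Subgroup.coe_mul, MulAut.conjNormal_apply]
  dsimp only
  rw [map_mul, toAdd_mul, neg_add, add_comm, zpow_add]
  group

theorem fox_one : fox hx 1 = 0 := by
  simpa [conjAb_one] using fox_mul hx 1 1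

theorem fox_self : fox hx x = 0 := by
  have : abKerMk ν 1 = 0 := rfl
  rw [fox, ← this]
  exact abKerMk_congr (by simp [hx])

theorem fox_inv (g : G) : fox hx g⁻¹ = - conjAb ν g (fox hx g) := by
  have h := fox_mul hx g⁻¹ g
  rw [inv_mul_cancel, fox_one, inv_inv] at h
  exact eq_neg_of_add_eq_zero_left h.symm

theorem fox_mul_self_inv (g : G) : fox hx (g * x⁻¹) = fox hx g := by
  rw [fox_mul, fox_inv, fox_self]
  simp

theorem fox_conj_self (g : G) :
    fox hx (x⁻¹ * g * x) = conjAb ν x (fox hx g) := by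
  rw [fox_mul, fox_mul, fox_inv, fox_self]
  simp

theorem fox_mul_of_ker {g : G} (hg : g ∈ ν.ker) (k : G) :
    fox hx (g * k) = fox hx g + fox hx k := by
  rw [fox_mul, conjAb_of_ker (inv_mem hg), Module.End.one_apply]

-- Finite order of the monodromy lets negative exponents be replaced by their remainders mod `m`, so
-- stability under conjugation need only be checked for `x`.
include hx in
theorem exists_conjAb_eq_pow {m : ℕ} (hm : 0 < m) (h : conjAb ν x ^ m = 1) (g : G) :
    ∃ n : ℕ, conjAb ν g = conjAb ν x ^ n := by
  refine ⟨((ν g).toAdd % m).toNat, ?_⟩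
  have h0 : (0 : ℤ) ≤ (ν g).toAdd % m := Int.emod_nonneg _ (by omega)
  have key : conjAb ν (x ^ ((ν g).toAdd / m * m)) = 1 := by
    have h1 : conjAb ν (x ^ m) = 1 := by rw [conjAb_pow, h]
    have h2 : conjAb ν (x ^ m)⁻¹ = 1 := by
      have := conjAb_mul (ν := ν) (x ^ m) (x ^ m)⁻¹
      rwa [mul_inv_cancel, conjAb_one, h1, mul_one, eq_comm] at this
    rw [mul_comm, zpow_mul, zpow_natCast]
    rcases Int.eq_nat_or_neg ((ν g).toAdd / m) with ⟨k, hk | hk⟩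
    · rw [hk, zpow_natCast, conjAb_pow, h1, one_pow]
    · rw [hk, zpow_neg, zpow_natCast, ← inv_pow, conjAb_pow, h2, one_pow]
  have e : conjAb ν g = conjAb ν (x ^ (ν g).toAdd) := conjAb_congr (by
    rw [map_zpow, hx, ← ofAdd_zsmul]
    simp)
  rw [← conjAb_pow, ← zpow_natCast, Int.toNat_of_nonneg h0, e]
  conv_lhs => rw [← Int.mul_ediv_add_emod (ν g).toAdd m, mul_comm (m : ℤ), zpow_add, conjAb_mul,
    key, mul_one]

/-- A submodule stable under conjugation and containing the values of `fox` on a generating set is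
everything. -/
theorem eq_top_of_fox_mem {s : Set G} (hs : Subgroup.closure s = ⊤) (W : Submodule ℤ (AbKer ν))
    (hW : ∀ g, ∀ a ∈ W, conjAb ν g a ∈ W) (hsW : ∀ g ∈ s, fox hx g ∈ W) : W = ⊤ := by
  have key : ∀ g : G, fox hx g ∈ W := fun g => by
    have hg : g ∈ Subgroup.closure s := hs ▸ Subgroup.mem_top g
    induction hg using Subgroup.closure_induction with
    | mem g hg => exact hsW g hg
    | one => rw [fox_one]; exact W.zero_mem
    | mul g k _ _ ihg ihk => rw [fox_mul]; exact W.add_mem ihg (hW _ _ ihk)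
    | inv g _ ih => rw [fox_inv]; exact W.neg_mem (hW _ _ ih)
  refine (Submodule.eq_top_iff').mpr fun a => ?_
  obtain ⟨n, rfl⟩ := abKerMk_surjective a
  rw [← fox_coe hx]
  exact key n

-- The finitely many translates of the `fox` values of generators by powers of the monodromy below
-- `m` span a stable submodule.
include hx in
theorem finite_abKer {s : Set G} (hfin : s.Finite) (hs : Subgroup.closure s = ⊤) {m : ℕ}
    (hm : 0 < m) (h : conjAb ν x ^ m = 1) : Module.Finite ℤ (AbKer ν) := by
  let T : Set (AbKer ν) := (fun p : ℕ × G => (conjAb ν x ^ p.1) (fox hx p.2)) '' (Set.Iio m ×ˢ s)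
  have hT : T.Finite := ((Set.finite_Iio m).prod hfin).image _
  refine ⟨⟨hT.toFinset, ?_⟩⟩
  rw [Set.Finite.coe_toFinset]
  refine eq_top_of_fox_mem hx hs _ (fun g a ha => ?_) fun g hg =>
    Submodule.subset_span ⟨(0, g), ⟨hm, hg⟩, rfl⟩
  obtain ⟨n, hn⟩ := exists_conjAb_eq_pow hx hm h g
  rw [hn]
  induction ha using Submodule.span_induction with
  | mem a ha =>
    obtain ⟨⟨i, k⟩, ⟨-, hk⟩, rfl⟩ := ha
    refine Submodule.subset_span ⟨((n + i) % m, k), ⟨Nat.mod_lt _ hm, hk⟩, ?_⟩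
    change (conjAb ν x ^ ((n + i) % m)) _ = (conjAb ν x ^ n * conjAb ν x ^ i) _
    rw [← pow_add]
    conv_rhs => rw [← Nat.mod_add_div (n + i) m, pow_add, pow_mul, h, one_pow, mul_one]
  | zero => simp
  | add a b _ _ iha ihb => rw [map_add]; exact add_mem iha ihb
  | smul c a _ ih => rw [map_smul]; exact Submodule.smul_mem _ _ ih

include hx in
theorem conjAb_sub_one_surjective {m : ℕ} (hm : 0 < m) (h : conjAb ν x ^ m = 1)
    (hc : ν.ker ≤ commutator G) : Function.Surjective (conjAb ν x - 1 : Module.End ℤ (AbKer ν)) := by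
  let W : Submodule ℤ (AbKer ν) := LinearMap.range (conjAb ν x - 1)
  have hsub : ∀ g a, conjAb ν g a - a ∈ W := fun g a => by
    obtain ⟨n, hn⟩ := exists_conjAb_eq_pow hx hm h g
    rw [hn]
    obtain ⟨q, hq⟩ := sub_one_dvd_pow_sub_one (conjAb ν x) n
    exact ⟨q a, (LinearMap.congr_fun hq a).symm⟩
  -- Modulo the range of `conjAb ν x - 1` the action is trivial, so `fox` becomes a homomorphism to
  -- an abelian group and vanishes on commutators.
  let D : G →* Multiplicative (AbKer ν ⧸ W) :=
    { toFun := fun g => Multiplicative.ofAdd (W.mkQ (fox hx g))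
      map_one' := by rw [fox_one, map_zero]; rfl
      map_mul' := fun g k => by
        rw [← ofAdd_add, fox_mul, map_add]
        congr 2
        exact (Submodule.Quotient.eq W).mpr (hsub _ _) }
  intro a
  obtain ⟨n, rfl⟩ := abKerMk_surjective a
  have hn : D n = 1 := Abelianization.commutator_subset_ker D (hc n.2)
  have hn' : W.mkQ (fox hx n) = 0 := hn
  rw [fox_coe, Submodule.mkQ_apply, Submodule.Quotient.mk_eq_zero] at hn'
  exact hn'

/-- `ν` induces a surjection from a copy of `ℤ` to `ℤ`, which must be injective; hence the kernel of
`ν` dies in the abelianization. -/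
theorem ker_le_commutator_of_mulEquiv (e : Abelianization G ≃* Multiplicative ℤ)
    (hν : Function.Surjective ν) : ν.ker ≤ commutator G := by
  let φ : Multiplicative ℤ →* Multiplicative ℤ :=
    (Abelianization.lift ν).comp e.symm.toMonoidHom
  have hφ : Function.Surjective φ := fun z => by
    obtain ⟨g, rfl⟩ := hν z
    exact ⟨e (Abelianization.of g), by simp [φ]⟩
  let ψ : ℤ →ₗ[ℤ] ℤ := AddMonoidHom.toIntLinearMap (MonoidHom.toAdditive φ)
  have hψ : Function.Injective ψ :=
    OrzechProperty.injective_of_surjective_endomorphism ψ fun z => hφ z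
  intro g hg
  rw [← Abelianization.ker_of, MonoidHom.mem_ker]
  have h1 : φ (e (Abelianization.of g)) = φ 1 := by
    rw [map_one]
    simpa [φ] using hg
  have h2 : e (Abelianization.of g) = 1 := hψ h1
  simpa using h2

end KernelModule

/-! ### Products of cyclotomic polynomials -/

section Cyclotomic

theorem cyclotomic_dvd_of_isPrimitiveRoot {P : ℤ[X]} {z : ℂ} {n : ℕ} (hn : 0 < n)
    (hz : IsPrimitiveRoot z n) (h : aeval z P = 0) : cyclotomic n ℤ ∣ P := by
  rw [cyclotomic_eq_minpoly hz hn]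
  exact minpoly.isIntegrallyClosed_dvd (hz.isIntegral hn) h

/-- The values at `1` for `n = 1, 2` are `0` and `2`, not units; for `n > 2` the value is positive.
-/
theorem two_lt_and_eval_one_cyclotomic {n : ℕ} (hn : 0 < n)
    (h : IsUnit ((cyclotomic n ℤ).eval 1)) : 2 < n ∧ (cyclotomic n ℤ).eval 1 = 1 := by
  have h2 : 2 < n := by
    by_contra! h2
    interval_cases n
    · simp at h
    · simp [cyclotomic_two, Int.isUnit_iff] at h
  have h0 : 0 ≤ (cyclotomic n ℤ).eval 1 := (cyclotomic_pos h2 1).le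
  refine ⟨h2, ?_⟩
  rcases Int.isUnit_iff.mp h with h | h <;> omega

/-- An integral polynomial whose complex roots are roots of unity is a constant times a product of
cyclotomic polynomials. -/
theorem exists_eq_C_mul_prod_cyclotomic (P : ℤ[X])
    (hP : ∀ z : ℂ, aeval z P = 0 → ∃ n : ℕ, 0 < n ∧ z ^ n = 1) :
    ∃ (c : ℤ) (s : Multiset ℕ), P = C c * (s.map fun n => cyclotomic n ℤ).prod ∧
      ∀ n ∈ s, 0 < n ∧ cyclotomic n ℤ ∣ P ∧ ∃ z : ℂ, IsPrimitiveRoot z n ∧ aeval z P = 0 := by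
  induction hd : P.natDegree using Nat.strong_induction_on generalizing P with
  | _ d ih =>
  by_cases hdeg : P.natDegree = 0
  · exact ⟨P.coeff 0, 0, by simpa using eq_C_of_natDegree_eq_zero hdeg, by simp⟩
  have hP0 : P ≠ 0 := by
    rintro rfl
    simp at hdeg
  obtain ⟨z, hz⟩ := IsAlgClosed.exists_aeval_eq_zero_of_injective ℂ
    (algebraMap ℤ ℂ).injective_int P
    (fun h => hdeg (natDegree_eq_zero_iff_degree_le_zero.mpr h.le))
  obtain ⟨k, hk, hzk⟩ := hP z hz
  have hn : 0 < orderOf z := orderOf_pos_iff.mpr (isOfFinOrder_iff_pow_eq_one.mpr ⟨k, hk, hzk⟩)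
  have hprim := IsPrimitiveRoot.orderOf z
  set n := orderOf z
  obtain ⟨Q, hQ⟩ := cyclotomic_dvd_of_isPrimitiveRoot hn hprim hz
  have hQ0 : Q ≠ 0 := by
    rintro rfl
    simp [hQ] at hP0
  have hlt : Q.natDegree < d := by
    rw [← hd, hQ, natDegree_mul (cyclotomic_ne_zero n ℤ) hQ0, natDegree_cyclotomic]
    have := Nat.totient_pos.mpr hn
    omega
  have hroot : ∀ w : ℂ, aeval w Q = 0 → aeval w P = 0 := fun w hw => by
    rw [hQ, map_mul, hw, mul_zero]
  obtain ⟨c, s, hs, hs'⟩ := ih _ hlt Q (fun w hw => hP w (hroot w hw)) rfl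
  refine ⟨c, n ::ₘ s, ?_, ?_⟩
  · rw [Multiset.map_cons, Multiset.prod_cons, mul_left_comm, ← hs, hQ]
  · intro m hm
    rcases Multiset.mem_cons.mp hm with rfl | hm
    · exact ⟨hn, ⟨Q, hQ⟩, z, hprim, hz⟩
    · obtain ⟨h1, h2, w, hw, hw'⟩ := hs' m hm
      exact ⟨h1, h2.trans (hQ ▸ dvd_mul_left Q _), w, hw, hroot w hw'⟩

theorem prod_cyclotomic_monic_even_eval_one (s : Multiset ℕ)
    (hs : ∀ n ∈ s, 2 < n ∧ (cyclotomic n ℤ).eval 1 = 1) :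
    (s.map fun n => cyclotomic n ℤ).prod.Monic ∧
      Even (s.map fun n => cyclotomic n ℤ).prod.natDegree ∧
      (s.map fun n => cyclotomic n ℤ).prod.eval 1 = 1 := by
  induction s using Multiset.induction with
  | empty => simp
  | cons n s ih =>
    obtain ⟨h1, h2, h3⟩ := ih fun m hm => hs m (Multiset.mem_cons_of_mem hm)
    obtain ⟨hn, hn'⟩ := hs n (Multiset.mem_cons_self n s)
    rw [Multiset.map_cons, Multiset.prod_cons]
    refine ⟨(cyclotomic.monic n ℤ).mul h1, ?_, by rw [eval_mul, hn', h3, one_mul]⟩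
    rw [(cyclotomic.monic n ℤ).natDegree_mul h1, natDegree_cyclotomic]
    exact (Nat.totient_even hn).add h2

end Cyclotomic

/-! ### Characteristic polynomials of automorphisms of finite order -/

section AlexanderRoots

/-- If `f - 1` is surjective on a finitely generated module, then `f` is annihilated by a polynomial
`r` with `r(1) = 1`. -/
theorem exists_aeval_eq_zero_and_eval_one {M : Type*} [AddCommGroup M] [Module.Finite ℤ M]
    (f : Module.End ℤ M) (hf : Function.Surjective (f - 1 : Module.End ℤ M)) :
    ∃ r : ℤ[X], aeval f r = 0 ∧ r.eval 1 = 1 := by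
  let I : Ideal ℤ[X] := Ideal.span {X - 1}
  -- Nakayama over `ℤ[X]`, with `X` acting as `f`: surjectivity of `f - 1` says `M = (X - 1) M`, and
  -- `r` is congruent to `1` modulo `X - 1`.
  obtain ⟨r, hr, hr'⟩ := Submodule.exists_sub_one_mem_and_smul_eq_zero_of_fg_of_le_smul
    I (⊤ : Submodule ℤ[X] (Module.AEval' f)) Module.Finite.fg_top (fun a _ => by
      obtain ⟨a, rfl⟩ := (Module.AEval'.of f).surjective a
      obtain ⟨b, rfl⟩ := hf a
      have : Module.AEval'.of f ((f - 1) b) = (X - 1 : ℤ[X]) • Module.AEval'.of f b := by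
        rw [sub_smul, Module.AEval'.X_smul_of, one_smul]
        simp
      rw [this]
      exact Submodule.smul_mem_smul (Ideal.mem_span_singleton_self _) Submodule.mem_top)
  refine ⟨r, LinearMap.ext fun a => ?_, ?_⟩
  · have := hr' (Module.AEval'.of f a) Submodule.mem_top
    rw [Module.AEval'.of, ← Module.AEval.of_aeval_smul] at this
    simpa using this
  · obtain ⟨q, hq⟩ := Ideal.mem_span_singleton'.mp hr
    have := congrArg (eval 1) hq
    simp only [eval_mul, eval_sub, eval_X, eval_one, sub_self, mul_zero] at this
    omega

theorem aeval_baseChange_eq_zero {M : Type*} [AddCommGroup M] (f : Module.End ℤ M) {r : ℤ[X]}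
    (h : aeval f r = 0) : aeval (LinearMap.baseChange ℂ f) r = 0 := by
  have := aeval_algHom_apply (Module.End.baseChangeHom ℤ ℂ M) f r
  rw [h, map_zero] at this
  exact this

theorem aeval_eq_zero_of_hasEigenvalue {V : Type*} [AddCommGroup V] [Module ℂ V]
    {f : Module.End ℂ V} {z : ℂ} (hz : f.HasEigenvalue z) {r : ℤ[X]} (h : aeval f r = 0) :
    aeval z r = 0 := by
  obtain ⟨v, hv⟩ := hz.exists_hasEigenvector
  have h1 := Module.End.aeval_apply_of_hasEigenvector (p := r.map (algebraMap ℤ ℂ)) hv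
  rw [aeval_map_algebraMap, h, LinearMap.zero_apply, eval_map_algebraMap] at h1
  exact (smul_eq_zero.mp h1.symm).resolve_right hv.2

/-- An integral polynomial that equals `det (f - t)` for the complexification of an endomorphism `f`
of finite order with `f - 1` surjective has roots of unity as roots and the value `1` at `1`. -/
theorem roots_and_eval_one_of_charpoly {M : Type*} [AddCommGroup M] [Module.Finite ℤ M]
    (f : Module.End ℤ M) (hf : Function.Surjective (f - 1 : Module.End ℤ M)) {m : ℕ} (hm : 0 < m)
    (hfm : f ^ m = 1) {P : ℤ[X]} (hP : (-1) ^ Module.finrank ℂ (ℂ ⊗[ℤ] M) *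
      (LinearMap.baseChange ℂ f).charpoly = P.map (Int.castRingHom ℂ)) :
    (∀ z : ℂ, aeval z P = 0 → ∃ n : ℕ, 0 < n ∧ z ^ n = 1) ∧ P.eval 1 = 1 := by
  obtain ⟨r, hr, hr1⟩ := exists_aeval_eq_zero_and_eval_one f hf
  have heig : ∀ z : ℂ, aeval z P = 0 →
      Module.End.HasEigenvalue (LinearMap.baseChange ℂ f) z := fun z hz => by
    rw [Module.End.hasEigenvalue_iff_isRoot_charpoly, IsRoot.def]
    have h : aeval z P = (P.map (Int.castRingHom ℂ)).eval z := (eval_map_algebraMap P z).symm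
    rw [hz, ← hP, eval_mul] at h
    simpa using h.symm
  have hroots : ∀ z : ℂ, aeval z P = 0 → ∃ n : ℕ, 0 < n ∧ z ^ n = 1 := fun z hz => by
    refine ⟨m, hm, ?_⟩
    have h := aeval_eq_zero_of_hasEigenvalue (heig z hz) (aeval_baseChange_eq_zero f
      (r := X ^ m - 1) (by simp [hfm]))
    simpa [sub_eq_zero] using h
  refine ⟨hroots, ?_⟩
  obtain ⟨c, s, hPs, hs⟩ := exists_eq_C_mul_prod_cyclotomic P hroots
  have hs' : ∀ n ∈ s, 2 < n ∧ (cyclotomic n ℤ).eval 1 = 1 := fun n hn => by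
    obtain ⟨h0, -, z, hz, hzP⟩ := hs n hn
    refine two_lt_and_eval_one_cyclotomic h0 (isUnit_of_dvd_one ?_)
    obtain ⟨q, hq⟩ := cyclotomic_dvd_of_isPrimitiveRoot h0 hz (aeval_eq_zero_of_hasEigenvalue
      (heig z hzP) (aeval_baseChange_eq_zero f hr))
    exact ⟨q.eval 1, by rw [← eval_mul, ← hq, hr1]⟩
  obtain ⟨hmon, heven, hone⟩ := prod_cyclotomic_monic_even_eval_one s hs'
  have hinj : Function.Injective (Int.castRingHom ℂ) := Int.cast_injective
  have hmonC := LinearMap.charpoly_monic (LinearMap.baseChange ℂ f)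
  have hunit : ((-1) ^ Module.finrank ℂ (ℂ ⊗[ℤ] M) : ℂ[X]) =
      C ((-1) ^ Module.finrank ℂ (ℂ ⊗[ℤ] M)) := by simp
  have hc0 : c ≠ 0 := by
    rintro rfl
    have : P = 0 := by rw [hPs, C_0, zero_mul]
    rw [this, Polynomial.map_zero] at hP
    exact mul_ne_zero (pow_ne_zero _ (neg_ne_zero.mpr one_ne_zero)) hmonC.ne_zero hP
  have hdeg : Module.finrank ℂ (ℂ ⊗[ℤ] M) = P.natDegree := by
    rw [← natDegree_map_eq_of_injective hinj, ← hP, hunit, natDegree_C_mul (by simp),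
      LinearMap.charpoly_natDegree]
  -- Every cyclotomic factor has even degree, so the sign is trivial and `P` is monic, which
  -- determines `c`.
  have heven' : Even (Module.finrank ℂ (ℂ ⊗[ℤ] M)) := by
    rwa [hdeg, hPs, natDegree_C_mul hc0]
  rw [heven'.neg_one_pow, one_mul] at hP
  have hlead : P.leadingCoeff = 1 := by
    apply hinj
    rw [map_one, ← leadingCoeff_map_of_injective hinj, ← hP, hmonC]
  rw [hPs, leadingCoeff_mul, leadingCoeff_C, hmon, mul_one] at hlead
  rw [hPs, hlead, eval_mul, hone]
  simp

end AlexanderRoots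

/-! ### Necessity: the central product of a Hurwitz presentation -/

namespace CPresentation

variable {G : Type*} [Group G]

theorem closure_range_gen (S : CPresentation G) : Subgroup.closure (Set.range S.gen) = ⊤ := by
  rw [← FreeGroup.range_lift_eq_closure]
  exact MonoidHom.range_eq_top.mpr S.lift_surjective

theorem hC_eq_baseChange (S : CPresentation G) :
    S.hC = LinearMap.baseChange ℂ (conjAb S.nu S.baseGen) := rfl

theorem IsIrreducible.deg_pos {S : CPresentation G} (hS : S.IsIrreducible) : 0 < S.deg := by
  by_contra! h
  obtain ⟨e⟩ := hS
  have htop := S.closure_range_gen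
  have : IsEmpty (Fin S.deg) := ⟨fun i => h.not_gt i.pos⟩
  rw [Set.range_eq_empty, Subgroup.closure_empty] at htop
  have hsub : Subsingleton G := Subgroup.subsingleton_iff.mp
    (subsingleton_of_bot_eq_top htop)
  have hab : Subsingleton (Abelianization G) :=
    (QuotientGroup.mk_surjective (s := commutator G)).subsingleton
  have := e.symm.injective (Subsingleton.elim (e.symm (Multiplicative.ofAdd (1 : ℤ))) (e.symm 1))
  exact absurd this (by decide)

theorem nu_baseGen {S : CPresentation G} (h : 0 < S.deg) :
    S.nu S.baseGen = Multiplicative.ofAdd (1 : ℤ) := by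
  rw [baseGen, dif_pos h, S.nu_gen]

theorem nu_surjective {S : CPresentation G} (h : 0 < S.deg) : Function.Surjective S.nu := fun z =>
  ⟨S.baseGen ^ z.toAdd, by rw [map_zpow, nu_baseGen h, ← ofAdd_zsmul]; simp⟩

/-- The product of the generators of a Hurwitz presentation is central. -/
theorem IsHurwitzPresentation.commute {T : CPresentation G} (hT : T.IsHurwitzPresentation) (g : G) :
    Commute (List.ofFn T.gen).prod g := by
  have hgen : ∀ i, Commute (List.ofFn T.gen).prod (T.gen i) := fun i => by
    have h : (FreeGroup.of i)⁻¹ * (((List.ofFn fun j : Fin T.deg => FreeGroup.of j).prod)⁻¹ *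
        FreeGroup.of i * (List.ofFn fun j : Fin T.deg => FreeGroup.of j).prod) ∈
        (FreeGroup.lift T.gen).ker := by
      rw [T.ker_lift]
      exact Subgroup.subset_normalClosure ⟨i, i, _, hT i, rfl⟩
    have hp : FreeGroup.lift T.gen (List.ofFn fun j : Fin T.deg => FreeGroup.of j).prod =
        (List.ofFn T.gen).prod := by
      rw [map_list_prod, List.map_ofFn]
      congr 2
      ext i
      simp
    rw [MonoidHom.mem_ker, map_mul, map_mul, map_mul, map_inv, map_inv, hp,
      FreeGroup.lift_apply_of, inv_mul_eq_one, mul_assoc, eq_inv_mul_iff_mul_eq] at h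
    exact h
  have hg : g ∈ Subgroup.closure (Set.range T.gen) := T.closure_range_gen ▸ Subgroup.mem_top g
  induction hg using Subgroup.closure_induction with
  | mem g hg => obtain ⟨i, rfl⟩ := hg; exact hgen i
  | one => exact Commute.one_right _
  | mul g k _ _ hg hk => exact hg.mul_right hk
  | inv g _ hg => exact hg.inv_right

theorem IsHurwitz.exists_conjAb_pow {S : CPresentation G} (hS : S.IsHurwitz) (h0 : 0 < S.deg) :
    ∃ m : ℕ, 0 < m ∧ conjAb S.nu S.baseGen ^ m = 1 := by
  obtain ⟨T, hTS, hT⟩ := hS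
  -- `T` may differ from `S`, but its generators are `C`-generators of `S`, so `S.nu` counts them
  -- correctly.
  have hnu : ∀ i, S.nu (T.gen i) = Multiplicative.ofAdd (1 : ℤ) := fun i =>
    S.nu_cGenerator (hTS ▸ ⟨i, IsConj.refl _⟩)
  refine ⟨T.deg, ?_, ?_⟩
  · have : S.gen ⟨0, h0⟩ ∈ T.cGenerators := hTS ▸ ⟨_, IsConj.refl _⟩
    obtain ⟨i, -⟩ := this
    exact i.pos
  · have hprod : S.nu (List.ofFn T.gen).prod = S.nu (S.baseGen ^ T.deg) := by
      rw [map_list_prod, List.map_ofFn, map_pow, nu_baseGen h0]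
      have : (S.nu : G → _) ∘ T.gen = fun _ => Multiplicative.ofAdd (1 : ℤ) := funext hnu
      rw [this, List.ofFn_const, List.prod_replicate]
    rw [← conjAb_pow, ← conjAb_congr hprod]
    refine LinearMap.ext fun a => ?_
    obtain ⟨n, rfl⟩ := abKerMk_surjective a
    refine abKerMk_congr ?_
    have := (hT.commute (n : G)).eq
    change ((MulAut.conjNormal (List.ofFn T.gen).prod⁻¹ : MulAut S.nu.ker) n : G) = n
    rw [MulAut.conjNormal_apply, inv_inv, mul_assoc, ← this, inv_mul_cancel_left]

/-- The Alexander polynomial of an irreducible Hurwitz `C`-group has only roots of unity as roots and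
takes the value `1` at `1`. -/
theorem roots_and_eval_one_of_isHurwitz {S : CPresentation G} (hI : S.IsIrreducible)
    (hH : S.IsHurwitz) {P : ℤ[X]} (hP : S.alexanderPolynomial = P.map (Int.castRingHom ℂ)) :
    (∀ z : ℂ, aeval z P = 0 → ∃ n : ℕ, 0 < n ∧ z ^ n = 1) ∧ P.eval 1 = 1 := by
  have h0 := hI.deg_pos
  obtain ⟨m, hm, hpow⟩ := hH.exists_conjAb_pow h0
  have hx := nu_baseGen h0
  obtain ⟨e⟩ := hI
  have hsurj := conjAb_sub_one_surjective hx hm hpow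
    (ker_le_commutator_of_mulEquiv e (nu_surjective h0))
  have hfin : Module.Finite ℤ (AbKer S.nu) :=
    finite_abKer hx (Set.finite_range S.gen) S.closure_range_gen hm hpow
  have hfinC : FiniteDimensional ℂ S.NC := inferInstanceAs (Module.Finite ℂ (ℂ ⊗[ℤ] AbKer S.nu))
  rw [alexanderPolynomial, dif_pos hfinC, hC_eq_baseChange] at hP
  exact roots_and_eval_one_of_charpoly _ hsurj hm hpow hP

end CPresentation

/-! ### Integral matrices of finite order -/

section CyclotomicMatrix

/-- The matrix is multiplication by a primitive root of unity `ζ` on `ℤ[ζ]` in the power basis. -/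
theorem exists_matrix_charpoly_eq_cyclotomic {n : ℕ} (hn : 0 < n) :
    ∃ (d : ℕ) (A : Matrix (Fin d) (Fin d) ℤ), A ^ n = 1 ∧ A.charpoly = cyclotomic n ℤ := by
  have hz : IsPrimitiveRoot (Complex.exp (2 * Real.pi * Complex.I / n)) n :=
    Complex.isPrimitiveRoot_exp n hn.ne'
  have hint := hz.isIntegral hn
  let pb := Algebra.adjoin.powerBasis' hint
  have hA : (Algebra.leftMulMatrix pb.basis pb.gen).charpoly = cyclotomic n ℤ := by
    rw [charpoly_leftMulMatrix, ← Algebra.adjoin.powerBasis'_minpoly_gen hint,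
      ← cyclotomic_eq_minpoly hz hn]
  refine ⟨_, Algebra.leftMulMatrix pb.basis pb.gen, ?_, hA⟩
  obtain ⟨q, hq⟩ := cyclotomic.dvd_X_pow_sub_one n ℤ
  have h := congrArg (aeval (Algebra.leftMulMatrix pb.basis pb.gen)) hq
  rw [map_mul, ← hA, Matrix.aeval_self_charpoly, zero_mul] at h
  simpa [sub_eq_zero] using h

theorem exists_matrix_charpoly_eq_prod_cyclotomic (s : Multiset ℕ) (hs : ∀ n ∈ s, 0 < n) :
    ∃ (d : ℕ) (A : Matrix (Fin d) (Fin d) ℤ) (k : ℕ), 0 < k ∧ A ^ k = 1 ∧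
      A.charpoly = (s.map fun n => cyclotomic n ℤ).prod := by
  induction s using Multiset.induction with
  | empty => exact ⟨0, 1, 1, one_pos, one_pow 1, by simp⟩
  | cons n s ih =>
    obtain ⟨d, A, k, hk, hA, hAs⟩ := ih fun m hm => hs m (Multiset.mem_cons_of_mem hm)
    have hn := hs n (Multiset.mem_cons_self n s)
    obtain ⟨d', B, hB, hBn⟩ := exists_matrix_charpoly_eq_cyclotomic hn
    refine ⟨d' + d, Matrix.reindexAlgEquiv ℤ ℤ finSumFinEquiv (Matrix.fromBlocks B 0 0 A), n * k,
      Nat.mul_pos hn hk, ?_, ?_⟩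
    · rw [← map_pow, Matrix.fromBlocks_diagonal_pow, pow_mul, hB, one_pow, mul_comm, pow_mul, hA,
        one_pow, Matrix.fromBlocks_one, map_one]
    · rw [Matrix.coe_reindexAlgEquiv, Matrix.charpoly_reindex, Matrix.charpoly_fromBlocks_zero₁₂,
        hBn, hAs, Multiset.map_cons, Multiset.prod_cons]

end CyclotomicMatrix

/-! ### The crossed homomorphism on the kernel -/

section KernelModule

variable {G : Type*} [Group G] {ν : G →* Multiplicative ℤ} {x : G}
  (hx : ν x = Multiplicative.ofAdd 1)

theorem fox_zpow_of_ker {g : G} (hg : g ∈ ν.ker) (z : ℤ) : fox hx (g ^ z) = z • fox hx g := by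
  rw [fox_of_ker hx hg, fox_of_ker hx (zpow_mem hg z)]
  exact congrArg Additive.ofMul (map_zpow Abelianization.of (⟨g, hg⟩ : ν.ker) z)

theorem fox_inv_of_ker {g : G} (hg : g ∈ ν.ker) : fox hx g⁻¹ = -fox hx g := by
  rw [fox_inv, conjAb_of_ker hg, Module.End.one_apply]

theorem fox_list_prod_of_ker (l : List G) (hl : ∀ g ∈ l, g ∈ ν.ker) :
    fox hx l.prod = (l.map (fox hx)).sum := by
  induction l with
  | nil => exact fox_one hx
  | cons g l ih =>
    rw [List.prod_cons, fox_mul_of_ker hx (hl g List.mem_cons_self),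
      ih fun k hk => hl k (List.mem_cons_of_mem g hk), List.map_cons, List.sum_cons]

end KernelModule

/-! ### The mapping torus of an automorphism -/

section MappingTorus

variable {M : Type*} [AddCommGroup M] (f : M ≃+ M)

/-- The action of `ℤ` on `M` in which `1` acts by the inverse of `f`. -/
def torusAction : Multiplicative ℤ →* MulAut (Multiplicative M) :=
  zpowersHom _ (AddEquiv.toMultiplicative f)⁻¹

/-- The semidirect product of `M` and `ℤ`, in which conjugation `g ↦ x⁻¹ g x` by the generator `x`
of `ℤ` restricts to `f`. -/
abbrev MappingTorus : Type _ := Multiplicative M ⋊[torusAction f] Multiplicative ℤ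

namespace MappingTorus

/-- The element `(a, 1)`. -/
def pt (a : M) : MappingTorus f := ⟨Multiplicative.ofAdd a, Multiplicative.ofAdd 1⟩

/-- The inclusion of `M`. -/
def incl (a : M) : MappingTorus f := SemidirectProduct.inl (Multiplicative.ofAdd a)

variable {f}

theorem incl_add (a b : M) : incl f (a + b) = incl f a * incl f b :=
  map_mul SemidirectProduct.inl (Multiplicative.ofAdd a) (Multiplicative.ofAdd b)

theorem incl_zero : incl f 0 = 1 := map_one SemidirectProduct.inl

theorem incl_neg (a : M) : incl f (-a) = (incl f a)⁻¹ :=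
  map_inv SemidirectProduct.inl (Multiplicative.ofAdd a)

theorem incl_zsmul (z : ℤ) (a : M) : incl f (z • a) = incl f a ^ z :=
  map_zpow SemidirectProduct.inl (Multiplicative.ofAdd a) z

theorem incl_list_sum (l : List M) : incl f l.sum = (l.map (incl f)).prod := by
  induction l with
  | nil => exact incl_zero
  | cons a l ih => rw [List.sum_cons, incl_add, ih, List.map_cons, List.prod_cons]

theorem pt_zero : pt f 0 = SemidirectProduct.inr (Multiplicative.ofAdd 1) := rfl

theorem pt_eq_incl_mul (a : M) : pt f a = incl f a * pt f 0 :=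
  SemidirectProduct.mk_eq_inl_mul_inr _ _

theorem pt_zero_conj (a : M) : (pt f 0)⁻¹ * incl f a * pt f 0 = incl f (f a) := by
  rw [pt_zero, incl, ← map_inv, ← SemidirectProduct.inl_aut_inv]
  simp [torusAction, incl]
  rfl

/-- Conjugating `(0, 1)` by elements of `M` changes its first coordinate by values of `f - 1`, up to
sign and a twist by `f`; these exhaust `M`. -/
theorem exists_conj_pt (hf : ∀ a, ∃ b, f b - b = a) (a : M) :
    ∃ b, pt f a = (incl f b)⁻¹ * pt f 0 * incl f b := by
  obtain ⟨c, hc⟩ := hf (-a)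
  refine ⟨f c, ?_⟩
  have h : pt f 0 * incl f (f c) = incl f c * pt f 0 := by
    rw [← pt_zero_conj]
    group
  rw [pt_eq_incl_mul, mul_assoc, h, ← mul_assoc,
    ← incl_neg, ← incl_add, ← neg_eq_iff_eq_neg.mpr hc]
  congr 2
  abel

theorem commute_pt_zero_pow {k : ℕ} (hk : ∀ a, f^[k] a = a) (g : MappingTorus f) :
    Commute (pt f 0 ^ k) g := by
  have h1 : ∀ (n : ℕ) (a : M), (pt f 0 ^ n)⁻¹ * incl f a * pt f 0 ^ n = incl f (f^[n] a) := by
    intro n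
    induction n with
    | zero => simp
    | succ n ih =>
      intro a
      rw [Function.iterate_succ_apply, ← ih, ← pt_zero_conj, pow_succ']
      group
  have h2 : ∀ a, Commute (pt f 0 ^ k) (incl f a) := fun a => by
    have := h1 k a
    rw [hk, mul_assoc, inv_mul_eq_iff_eq_mul] at this
    exact this.symm
  rw [← SemidirectProduct.inl_left_mul_inr_right g]
  refine Commute.mul_right (h2 (Multiplicative.toAdd g.left)) ?_
  rw [pt_zero, ← map_pow]
  exact (Commute.all _ _).map SemidirectProduct.inr

/-- Conjugate elements have conjugate `k`-th powers, and `pt f 0 ^ k` is central. -/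
theorem pt_pow (hf : ∀ a, ∃ b, f b - b = a) {k : ℕ} (hk : ∀ a, f^[k] a = a) (a : M) :
    pt f a ^ k = pt f 0 ^ k := by
  obtain ⟨b, hb⟩ := exists_conj_pt hf a
  have h := conj_pow (i := k) (a := (incl f b)⁻¹) (b := pt f 0)
  rw [inv_inv, ← hb] at h
  rw [h, mul_assoc, (commute_pt_zero_pow hk _).eq, inv_mul_cancel_left]

/-- A subgroup that contains the elements `(0, 1)` and `(b i, 1)`, for a spanning family `b`,
contains `M`. -/
theorem incl_mem {ι : Type*} {b : ι → M} (hb : Submodule.span ℤ (Set.range b) = ⊤)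
    {K : Subgroup (MappingTorus f)} (h0 : pt f 0 ∈ K) (hbK : ∀ i, pt f (b i) ∈ K) (a : M) :
    incl f a ∈ K := by
  have ha : a ∈ Submodule.span ℤ (Set.range b) := hb ▸ Submodule.mem_top
  induction ha using Submodule.span_induction with
  | mem a ha =>
    obtain ⟨i, rfl⟩ := ha
    rw [← mul_inv_cancel_right (incl f (b i)) (pt f 0), ← pt_eq_incl_mul]
    exact K.mul_mem (hbK i) (K.inv_mem h0)
  | zero => rw [incl_zero]; exact K.one_mem
  | add a c _ _ iha ihc => rw [incl_add]; exact K.mul_mem iha ihc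
  | smul z a _ ih => rw [incl_zsmul]; exact K.zpow_mem ih z

end MappingTorus

end MappingTorus

/-! ### Groups defined by finite sets of `C`-relations -/

namespace CPresentation

/-- The set of defining relators of a set of triples. -/
def relators {m : ℕ} (R : Set (Fin m × Fin m × FreeGroup (Fin m))) : Set (FreeGroup (Fin m)) :=
  {r | ∃ i j w, (i, j, w) ∈ R ∧ r = (FreeGroup.of i)⁻¹ * (w⁻¹ * FreeGroup.of j * w)}

/-- The `C`-group defined by a finite set of triples. -/
def ofRel {m : ℕ} {R : Set (Fin m × Fin m × FreeGroup (Fin m))} (hR : R.Finite) :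
    CPresentation (PresentedGroup (relators R)) where
  deg := m
  gen := PresentedGroup.of
  rel := R
  rel_finite := hR
  lift_surjective := by
    have : FreeGroup.lift PresentedGroup.of = PresentedGroup.mk (relators R) := by
      ext
      simp [PresentedGroup.of]
    rw [this]
    exact PresentedGroup.mk_surjective _
  ker_lift := by
    have : FreeGroup.lift PresentedGroup.of = PresentedGroup.mk (relators R) := by
      ext
      simp [PresentedGroup.of]
    rw [this]
    exact QuotientGroup.ker_mk' _

variable {G : Type*} [Group G]

theorem gen_eq_conj (S : CPresentation G) {i j : Fin S.deg} {w : FreeGroup (Fin S.deg)}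
    (h : (i, j, w) ∈ S.rel) :
    S.gen i = (FreeGroup.lift S.gen w)⁻¹ * S.gen j * FreeGroup.lift S.gen w := by
  have h' : (FreeGroup.of i)⁻¹ * (w⁻¹ * FreeGroup.of j * w) ∈ (FreeGroup.lift S.gen).ker := by
    rw [S.ker_lift]
    exact Subgroup.subset_normalClosure ⟨i, j, w, h, rfl⟩
  rw [MonoidHom.mem_ker] at h'
  simpa [inv_mul_eq_one] using h'

theorem isIrreducible_of_conj (S : CPresentation G) (h0 : 0 < S.deg)
    (h : ∀ i, IsConj (S.gen i) S.baseGen) : S.IsIrreducible := by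
  have hab : ∀ g : G, Abelianization.of g = Abelianization.of S.baseGen ^ (S.nu g).toAdd := by
    intro g
    have hg : g ∈ Subgroup.closure (Set.range S.gen) := S.closure_range_gen ▸ Subgroup.mem_top g
    induction hg using Subgroup.closure_induction with
    | mem g hg =>
      obtain ⟨i, rfl⟩ := hg
      rw [S.nu_gen, isConj_iff_eq.mp ((Abelianization.of (G := G)).map_isConj (h i))]
      simp
    | one => simp
    | mul g k _ _ hg hk => rw [map_mul, map_mul, toAdd_mul, zpow_add, hg, hk]
    | inv g _ hg => rw [map_inv, map_inv, toAdd_inv, zpow_neg, hg]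
  refine ⟨MulEquiv.ofBijective (Abelianization.lift S.nu) ⟨?_, fun z => ?_⟩⟩
  · rw [injective_iff_map_eq_one]
    intro a ha
    obtain ⟨g, rfl⟩ := QuotientGroup.mk_surjective a
    change S.nu g = 1 at ha
    change Abelianization.of g = 1
    rw [hab, ha]
    simp
  · obtain ⟨g, rfl⟩ := nu_surjective h0 z
    exact ⟨Abelianization.of g, rfl⟩

end CPresentation

/-! ### Words that prescribe the monodromy -/

section MonodromyWord

/-- The word expressing that conjugation by `x` acts on the elements `s j * x⁻¹` by the matrix
`A`. -/
def monodromyWord {G : Type*} [Group G] {d : ℕ} (A : Matrix (Fin d) (Fin d) ℤ) (x : G)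
    (s : Fin d → G) (j : Fin d) : G :=
  x⁻¹ * (s j * x⁻¹) * x * (List.ofFn fun l => (s l * x⁻¹) ^ A l j).prod⁻¹

variable {G : Type*} [Group G] {d : ℕ} (A : Matrix (Fin d) (Fin d) ℤ)

theorem map_monodromyWord {H : Type*} [Group H] (φ : G →* H) (x : G) (s : Fin d → G) (j : Fin d) :
    φ (monodromyWord A x s j) = monodromyWord A (φ x) (φ ∘ s) j := by
  simp only [monodromyWord, map_mul, map_inv, map_list_prod, List.map_ofFn]
  congr 4
  ext l
  simp

theorem monodromyWord_pt {M : Type*} [AddCommGroup M] {f : M ≃+ M} {b : Fin d → M}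
    (hA : ∀ j, f (b j) = ∑ l, A l j • b l) (j : Fin d) :
    monodromyWord A (MappingTorus.pt f 0) (fun l => MappingTorus.pt f (b l)) j = 1 := by
  have h : ∀ a : M, MappingTorus.pt f a * (MappingTorus.pt f 0)⁻¹ = MappingTorus.incl f a :=
    fun a => by rw [MappingTorus.pt_eq_incl_mul, mul_inv_cancel_right]
  simp only [monodromyWord, h, MappingTorus.pt_zero_conj, hA, ← MappingTorus.incl_zsmul]
  rw [mul_inv_eq_one, ← List.sum_ofFn, MappingTorus.incl_list_sum, List.map_ofFn]
  rfl

variable {ν : G →* Multiplicative ℤ} {x : G} (hx : ν x = Multiplicative.ofAdd 1)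
  {s : Fin d → G} (hs : ∀ j, ν (s j) = Multiplicative.ofAdd 1)

include hx hs in
theorem mul_inv_mem_ker (j : Fin d) : s j * x⁻¹ ∈ ν.ker := by
  rw [MonoidHom.mem_ker, map_mul, map_inv, hx, hs, mul_inv_cancel]

include hs in
/-- If the words `monodromyWord A x s j` commute with `x`, then the monodromy is given by the
matrix `A`. -/
theorem conjAb_fox_of_commute
    (hinj : Function.Injective (conjAb ν x - 1 : Module.End ℤ (AbKer ν)))
    (hc : ∀ j, Commute x (monodromyWord A x s j)) (j : Fin d) :
    conjAb ν x (fox hx (s j)) = ∑ l, A l j • fox hx (s l) := by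
  have h1 : ∀ g ∈ List.ofFn fun l => (s l * x⁻¹) ^ A l j, g ∈ ν.ker := by
    intro g hg
    obtain ⟨l, rfl⟩ := (List.mem_ofFn' _ _).mp hg
    exact zpow_mem (mul_inv_mem_ker hx hs l) _
  have h2 : x⁻¹ * (s j * x⁻¹) * x ∈ ν.ker := by
    have := (MonoidHom.normal_ker ν).conj_mem _ (mul_inv_mem_ker hx hs j) x⁻¹
    rwa [inv_inv] at this
  have h3 : fox hx (monodromyWord A x s j) =
      conjAb ν x (fox hx (s j)) - ∑ l, A l j • fox hx (s l) := by
    rw [monodromyWord, fox_mul_of_ker hx h2, fox_conj_self, fox_mul_self_inv,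
      fox_inv_of_ker hx (list_prod_mem h1), fox_list_prod_of_ker hx _ h1, List.map_ofFn,
      List.sum_ofFn, sub_eq_add_neg]
    congr 2
    refine Finset.sum_congr rfl fun l _ => ?_
    rw [Function.comp_apply, fox_zpow_of_ker hx (mul_inv_mem_ker hx hs l), fox_mul_self_inv]
  -- Commuting with `x` makes the class of the word a fixed vector of the monodromy; injectivity of
  -- `conjAb ν x - 1` then kills it.
  have h4 : conjAb ν x (fox hx (monodromyWord A x s j)) = fox hx (monodromyWord A x s j) := by
    rw [← fox_conj_self hx, mul_assoc, ← (hc j).eq, inv_mul_cancel_left]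
  have h5 : fox hx (monodromyWord A x s j) = 0 := hinj (by simp [h4])
  exact sub_eq_zero.mp (h3.symm.trans h5)

end MonodromyWord

/-! ### Computing the Alexander polynomial -/

namespace CPresentation

variable {G : Type*} [Group G]

/-- The Alexander polynomial is the characteristic polynomial of `A` (up to sign) if the monodromy is
given by `A` on generators whose images in a mapping torus of `ℤᵈ` form a basis. -/
theorem alexanderPolynomial_eq_charpoly (S : CPresentation G) (hI : S.IsIrreducible)
    (hH : S.IsHurwitz) {M : Type*} [AddCommGroup M] {f : M ≃+ M} {d : ℕ} {b : Fin d → M}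
    (hb : LinearIndependent ℤ b) (A : Matrix (Fin d) (Fin d) ℤ) (F : G →* MappingTorus f)
    (hF : ∀ i, (F (S.gen i)).right = Multiplicative.ofAdd 1)
    (hF0 : F S.baseGen = MappingTorus.pt f 0) (s : Fin d → G)
    (hs : ∀ j, F (s j) = MappingTorus.pt f (b j))
    (hgen : ∀ i, S.gen i = S.baseGen ∨ ∃ j, S.gen i = s j)
    (hc : ∀ j, Commute S.baseGen (monodromyWord A S.baseGen s j)) :
    S.alexanderPolynomial = (-1) ^ d * A.charpoly.map (Int.castRingHom ℂ) := by
  have h0 := hI.deg_pos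
  have hx := nu_baseGen h0
  obtain ⟨m, hm, hpow⟩ := hH.exists_conjAb_pow h0
  have hfin : Module.Finite ℤ (AbKer S.nu) :=
    finite_abKer hx (Set.finite_range S.gen) S.closure_range_gen hm hpow
  have hinj : Function.Injective (conjAb S.nu S.baseGen - 1 : Module.End ℤ (AbKer S.nu)) := by
    obtain ⟨e⟩ := hI
    exact OrzechProperty.injective_of_surjective_endomorphism _ (conjAb_sub_one_surjective hx hm hpow
      (ker_le_commutator_of_mulEquiv e (nu_surjective h0)))
  have hν : ∀ g, (F g).right = S.nu g := by
    have : (SemidirectProduct.rightHom.comp F : G →* Multiplicative ℤ) = S.nu :=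
      MonoidHom.eq_of_eqOn_dense S.closure_range_gen (by
        rintro _ ⟨i, rfl⟩
        exact (hF i).trans (S.nu_gen i).symm)
    exact DFunLike.congr_fun this
  have hsν : ∀ j, S.nu (s j) = Multiplicative.ofAdd 1 := fun j => by rw [← hν, hs]; rfl
  -- The first coordinate of `F` is multiplicative on the kernel of `ν`, where the second coordinate
  -- is trivial.
  let θ : S.nu.ker →* Multiplicative M :=
    { toFun := fun n => (F n).left
      map_one' := by simp
      map_mul' := fun n k => by
        rw [Subgroup.coe_mul, map_mul, SemidirectProduct.mul_left, hν, show S.nu n = 1 from n.2,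
          map_one, MulAut.one_apply] }
  let Θ : AbKer S.nu →ₗ[ℤ] M :=
    AddMonoidHom.toIntLinearMap (MonoidHom.toAdditiveLeft (Abelianization.lift θ))
  have hΘ : ∀ j, Θ (fox hx (s j)) = b j := fun j => by
    rw [← fox_mul_self_inv, fox_of_ker hx (mul_inv_mem_ker hx hsν j)]
    change Multiplicative.toAdd (F (s j * S.baseGen⁻¹)).left = b j
    rw [map_mul, map_inv, hs, hF0, MappingTorus.pt_eq_incl_mul, mul_inv_cancel_right]
    rfl
  have hrel := conjAb_fox_of_commute A hx hsν hinj hc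
  have hspan : Submodule.span ℤ (Set.range fun j => fox hx (s j)) = ⊤ := by
    refine eq_top_of_fox_mem hx S.closure_range_gen _ (fun g a ha => ?_) ?_
    · obtain ⟨n, hn⟩ := exists_conjAb_eq_pow hx hm hpow g
      rw [hn]
      have hle : Submodule.span ℤ (Set.range fun j => fox hx (s j)) ≤
          (Submodule.span ℤ (Set.range fun j => fox hx (s j))).comap
            (conjAb S.nu S.baseGen) := by
        rw [Submodule.span_le]
        rintro _ ⟨j, rfl⟩
        change conjAb S.nu S.baseGen _ ∈ Submodule.span _ _
        rw [hrel]
        exact sum_mem fun l _ => Submodule.smul_mem _ _ (Submodule.subset_span ⟨l, rfl⟩)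
      clear hn
      induction n with
      | zero => exact ha
      | succ n ih => rw [pow_succ']; exact hle ih
    · rintro _ ⟨i, rfl⟩
      rcases hgen i with h | ⟨j, h⟩
      · rw [h, fox_self]
        exact Submodule.zero_mem _
      · rw [h]
        exact Submodule.subset_span ⟨j, rfl⟩
  -- Independence is pulled back along `Θ`, which sends these classes to `b`.
  have hli : LinearIndependent ℤ fun j => fox hx (s j) :=
    LinearIndependent.of_comp Θ (by convert hb using 1; exact funext hΘ)
  let B := Module.Basis.mk hli hspan.ge
  have hfree : Module.Free ℤ (AbKer S.nu) := Module.Free.of_basis B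
  have hB : Matrix.toLin B B A = conjAb S.nu S.baseGen := B.ext fun j => by
    rw [Matrix.toLin_self, Module.Basis.mk_apply, hrel]
    simp [B]
  have hfinC : FiniteDimensional ℂ S.NC := inferInstanceAs (Module.Finite ℂ (ℂ ⊗[ℤ] AbKer S.nu))
  have hrank : Module.finrank ℂ S.NC = d := by
    have : Module.finrank ℂ (ℂ ⊗[ℤ] AbKer S.nu) = d := by
      rw [Module.finrank_baseChange, Module.finrank_eq_card_basis B, Fintype.card_fin]
    exact this
  rw [alexanderPolynomial, dif_pos hfinC, hrank, hC_eq_baseChange, LinearMap.charpoly_baseChange,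
    ← hB, Matrix.charpoly_toLin]
  rfl

end CPresentation

/-! ### Sufficiency: construction of the Hurwitz group -/

section Realization

variable {M : Type} [AddCommGroup M] {f : M ≃+ M}

/-- An integral matrix of finite order that is the matrix of an automorphism `f` with `f - 1`
surjective is the monodromy of an irreducible Hurwitz `C`-group. -/
theorem exists_isHurwitz_of_basis {d : ℕ} (b : Module.Basis (Fin d) ℤ M)
    {A : Matrix (Fin d) (Fin d) ℤ} (hA : ∀ j, f (b j) = ∑ l, A l j • b l)
    (hf : ∀ a, ∃ c, f c - c = a) {k : ℕ} (hk : 0 < k) (hfk : ∀ a, f^[k] a = a) :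
    ∃ (G : Type) (_ : Group G) (S : CPresentation G), S.IsIrreducible ∧ S.IsHurwitz ∧
      S.alexanderPolynomial = (-1) ^ d * A.charpoly.map (Int.castRingHom ℂ) := by
  let p : Fin (d + 1) → M := Fin.cons 0 b
  -- The points `0, b 0, …, b (d - 1)` are each listed `k` times in a row; `idx i` is the first copy
  -- of the `i`-th.
  let idx : Fin (d + 1) → Fin ((d + 1) * k) := fun i => finProdFinEquiv (i, ⟨0, hk⟩)
  have hidx : ∀ i, (idx i).divNat = i := fun i =>
    congrArg Prod.fst (finProdFinEquiv.symm_apply_apply (i, (⟨0, hk⟩ : Fin k)))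
  let Y : Fin ((d + 1) * k) → MappingTorus f := fun i => MappingTorus.pt f (p i.divNat)
  have hY : ∀ i, Y (idx i) = MappingTorus.pt f (p i) := fun i => by simp only [Y, hidx]
  have hY0 : Y (idx 0) = MappingTorus.pt f 0 := hY 0
  have hYs : ∀ j : Fin d, Y (idx j.succ) = MappingTorus.pt f (b j) := fun j => by
    rw [hY]
    simp [p]
  have hmem : ∀ i, Y i ∈ (FreeGroup.lift Y).range := fun i =>
    ⟨FreeGroup.of i, FreeGroup.lift_apply_of⟩
  -- The conjugating element lies in `M`, hence is a word in the `Y i`, as a `C`-relation requires.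
  have hw : ∀ i, ∃ w, Y i = (FreeGroup.lift Y w)⁻¹ * Y (idx 0) * FreeGroup.lift Y w := fun i => by
    obtain ⟨a, ha⟩ := MappingTorus.exists_conj_pt hf (p i.divNat)
    obtain ⟨w, hw⟩ := MappingTorus.incl_mem b.span_eq (hY0 ▸ hmem (idx 0))
      (fun j => hYs j ▸ hmem (idx j.succ)) a
    exact ⟨w, by rw [hw, hY0]; exact ha⟩
  choose w hw using hw
  let u : FreeGroup (Fin ((d + 1) * k)) := (List.ofFn fun j => FreeGroup.of j).prod
  have hu : ∀ g, Commute (FreeGroup.lift Y u) g := fun g => by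
    have h : FreeGroup.lift Y u = (List.ofFn Y).prod := by
      rw [map_list_prod, List.map_ofFn]
      congr 2
      ext i : 1
      exact FreeGroup.lift_apply_of
    have h' : ∀ (i : Fin (d + 1)) (j : Fin k) (hij),
        Y ⟨i * k + j, hij⟩ = MappingTorus.pt f (p i) := fun i j hij => by
      have : (⟨i * k + j, hij⟩ : Fin ((d + 1) * k)).divNat = i := by
        ext
        simp [Fin.divNat, Nat.add_div_of_dvd_right, Nat.div_eq_of_lt j.2, hk]
      simp only [Y, this]
    -- The product splits into `d + 1` blocks, each a `k`-th power equal to the central element `pt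
    -- f 0 ^ k`.
    rw [h, List.ofFn_mul, List.prod_flatten, List.map_ofFn]
    have h'' : (List.ofFn (List.prod ∘ fun i : Fin (d + 1) => List.ofFn fun j : Fin k =>
        MappingTorus.pt f (p i))) = List.replicate (d + 1) (MappingTorus.pt f 0 ^ k) := by
      rw [← List.ofFn_const]
      congr 1
      ext i : 1
      rw [Function.comp_apply, List.ofFn_const, List.prod_replicate, MappingTorus.pt_pow hf hfk]
    simp only [h']
    rw [h'', List.prod_replicate]
    exact (MappingTorus.commute_pt_zero_pow hfk g).pow_left _
  let c : Fin d → FreeGroup (Fin ((d + 1) * k)) := fun j =>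
    monodromyWord A (FreeGroup.of (idx 0)) (fun l => FreeGroup.of (idx l.succ)) j
  have hc : ∀ j, FreeGroup.lift Y (c j) = 1 := fun j => by
    rw [map_monodromyWord, FreeGroup.lift_apply_of, hY0, ← monodromyWord_pt A hA j]
    congr 1
    ext l : 1
    rw [Function.comp_apply, FreeGroup.lift_apply_of, hYs]
  -- The four families give conjugacy to the base generator, the Hurwitz condition, commutation with
  -- the monodromy words, and equality of the `k` copies.
  let R : Set (Fin ((d + 1) * k) × Fin ((d + 1) * k) × FreeGroup (Fin ((d + 1) * k))) :=
    Set.range (fun i => (i, idx 0, w i)) ∪ Set.range (fun i => (i, i, u)) ∪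
      Set.range (fun j => (idx 0, idx 0, c j)) ∪ Set.range (fun i => (i, idx i.divNat, 1))
  have hR : R.Finite := (((Set.finite_range _).union (Set.finite_range _)).union
    (Set.finite_range _)).union (Set.finite_range _)
  have hRY : ∀ r ∈ CPresentation.relators R, FreeGroup.lift Y r = 1 := by
    rintro _ ⟨i, j, v, hv, rfl⟩
    rw [map_mul, map_mul, map_mul, map_inv, map_inv, FreeGroup.lift_apply_of,
      FreeGroup.lift_apply_of, inv_mul_eq_one]
    rcases hv with ((⟨i, h⟩ | ⟨i, h⟩) | ⟨i, h⟩) | ⟨i, h⟩ <;> cases h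
    · exact hw i
    · rw [mul_assoc, ← (hu _).eq, inv_mul_cancel_left]
    · simp [hc]
    · simp [hY, Y]
  let S := CPresentation.ofRel hR
  let F : PresentedGroup (CPresentation.relators R) →* MappingTorus f := PresentedGroup.toGroup hRY
  let x : Fin ((d + 1) * k) → PresentedGroup (CPresentation.relators R) := PresentedGroup.of
  have hF : ∀ i, F (x i) = Y i := fun i => PresentedGroup.toGroup.of hRY
  have hx : ∀ {i j v}, (i, j, v) ∈ R →
      x i = (FreeGroup.lift x v)⁻¹ * x j * FreeGroup.lift x v := fun h => S.gen_eq_conj h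
  have hpos : 0 < S.deg := Nat.mul_pos (Nat.succ_pos d) hk
  have hbase : S.baseGen = x (idx 0) := by
    rw [CPresentation.baseGen, dif_pos hpos]
    exact congrArg x (Fin.ext (by simp [idx]))
  have hrep : ∀ i, x i = x (idx i.divNat) := fun i => by
    simpa using hx (Or.inr ⟨i, rfl⟩ : (i, idx i.divNat, 1) ∈ R)
  have hI : S.IsIrreducible := S.isIrreducible_of_conj hpos fun i => by
    have h : x i = _ := hx (Or.inl (Or.inl (Or.inl ⟨i, rfl⟩)))
    rw [hbase, isConj_comm, isConj_iff]
    exact ⟨(FreeGroup.lift x (w i))⁻¹, by rw [inv_inv]; exact h.symm⟩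
  have hH : S.IsHurwitz := ⟨S, rfl, fun i => Or.inl (Or.inl (Or.inr ⟨i, rfl⟩))⟩
  refine ⟨_, _, S, hI, hH, S.alexanderPolynomial_eq_charpoly hI hH b.linearIndependent A F
    (fun i => congrArg SemidirectProduct.right (hF i)) (by rw [hbase, hF, hY0])
    (fun j => x (idx j.succ)) (fun j => by rw [hF, hYs]) (fun (i : Fin ((d + 1) * k)) => ?_)
    (fun j => ?_)⟩
  · change x i = _ ∨ ∃ j, x i = _
    rw [hbase, hrep i]
    rcases Fin.eq_zero_or_eq_succ (Fin.divNat i) with h | ⟨j, h⟩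
    · exact Or.inl (by rw [h])
    · exact Or.inr ⟨j, by rw [h]⟩
  · have h := hx (Or.inl (Or.inr ⟨j, rfl⟩) : (idx 0, idx 0, c j) ∈ R)
    have h' : FreeGroup.lift x (c j) =
        monodromyWord A S.baseGen (fun j => x (idx j.succ)) j := by
      rw [map_monodromyWord, FreeGroup.lift_apply_of, hbase]
      congr 1
    rw [← h', hbase]
    rw [mul_assoc, eq_inv_mul_iff_mul_eq] at h
    exact h.symm

theorem exists_isHurwitz_of_matrix {d : ℕ} {A : Matrix (Fin d) (Fin d) ℤ} {k : ℕ} (hk : 0 < k)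
    (hA : A ^ k = 1) (hA1 : A.charpoly.eval 1 = 1) :
    ∃ (G : Type) (_ : Group G) (S : CPresentation G), S.IsIrreducible ∧ S.IsHurwitz ∧
      S.alexanderPolynomial = (-1) ^ d * A.charpoly.map (Int.castRingHom ℂ) := by
  have hinv : A * A ^ (k - 1) = 1 := by rw [← pow_succ', Nat.sub_add_cancel hk, hA]
  have hinv' : A ^ (k - 1) * A = 1 := by rw [← pow_succ, Nat.sub_add_cancel hk, hA]
  let f : (Fin d → ℤ) ≃+ (Fin d → ℤ) :=
    { toFun := fun v => A.mulVec v
      invFun := fun v => (A ^ (k - 1)).mulVec v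
      left_inv := fun v => by simp [hinv']
      right_inv := fun v => by simp [hinv]
      map_add' := fun v w => Matrix.mulVec_add A v w }
  have hiter : ∀ (n : ℕ) (v : Fin d → ℤ), f^[n] v = (A ^ n).mulVec v := fun n => by
    induction n with
    | zero => simp
    | succ n ih =>
      intro v
      rw [Function.iterate_succ_apply, ih, pow_succ, ← Matrix.mulVec_mulVec]
      rfl
  -- The value of the characteristic polynomial at `1` is this determinant, so `A - 1` is invertible
  -- over `ℤ`.
  have hdet : (1 - A).det = 1 := by
    rw [← hA1, Matrix.eval_charpoly]
    simp
  have hunit : (1 - A) * (1 - A)⁻¹ = 1 := Matrix.mul_nonsing_inv _ (by simp [hdet])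
  refine exists_isHurwitz_of_basis (f := f) (Pi.basisFun ℤ (Fin d)) (fun j => ?_) (fun v => ?_) hk
    fun v => by rw [hiter, hA, Matrix.one_mulVec]
  · ext i
    change A.mulVec _ i = _
    simp [Pi.basisFun_apply, Finset.sum_apply, Pi.single_apply]
  · refine ⟨(1 - A)⁻¹.mulVec (-v), ?_⟩
    have h : (1 - A).mulVec ((1 - A)⁻¹.mulVec (-v)) = -v := by
      rw [Matrix.mulVec_mulVec, hunit, Matrix.one_mulVec]
    rw [Matrix.sub_mulVec, Matrix.one_mulVec] at h
    change A.mulVec _ - _ = v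
    rw [← neg_sub, h, neg_neg]

end Realization

end

theorem theorem0p1 (P : ℤ[X]) :
    (∃ (G : Type) (_ : Group G) (S : CPresentation G),
      S.IsIrreducible ∧ S.IsHurwitz ∧
        S.alexanderPolynomial = P.map (Int.castRingHom ℂ)) ↔
    (∀ z : ℂ, aeval z P = 0 → ∃ n : ℕ, 0 < n ∧ z ^ n = 1) ∧ P.eval 1 = 1 := by
  refine ⟨fun ⟨G, _, S, hI, hH, hP⟩ => S.roots_and_eval_one_of_isHurwitz hI hH hP,
    fun ⟨hroots, hone⟩ => ?_⟩
  obtain ⟨c, s, hPs, hs⟩ := exists_eq_C_mul_prod_cyclotomic P hroots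
  have hs' : ∀ n ∈ s, 2 < n ∧ (cyclotomic n ℤ).eval 1 = 1 := fun n hn => by
    obtain ⟨h0, ⟨q, hq⟩, -⟩ := hs n hn
    refine two_lt_and_eval_one_cyclotomic h0 (isUnit_of_dvd_one ⟨q.eval 1, ?_⟩)
    rw [← eval_mul, ← hq, hone]
  obtain ⟨-, heven, hprod⟩ := prod_cyclotomic_monic_even_eval_one s hs'
  have hc : c = 1 := by
    rw [hPs, eval_mul, hprod] at hone
    simpa using hone
  rw [hc, C_1, one_mul] at hPs
  obtain ⟨d, A, k, hk, hA, hAs⟩ := exists_matrix_charpoly_eq_prod_cyclotomic s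
    fun n hn => (hs n hn).1
  obtain ⟨G, hG, S, hI, hH, hS⟩ := exists_isHurwitz_of_matrix hk hA (by rw [hAs, hprod])
  -- An even size removes the sign `(-1) ^ d`.
  have hd : Even d := by
    have := Matrix.charpoly_natDegree_eq_dim A
    rw [Fintype.card_fin] at this
    rwa [← this, hAs]
  exact ⟨G, hG, S, hI, hH, by rw [hS, hd.neg_one_pow, one_mul, hAs, hPs]⟩
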